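/- Let $\rho$ be a qubit state, i.e. a positive semidefinite $2\times 2$ complex matrix with $\operatorname{tr}\rho=1$, and let $\mathcal P=\operatorname{tr}(\rho^2)$ be its purity. For an orthonormal basis $\mathbb X=\{|x_1\rangle,|x_2\rangle\}$ of $\mathbb C^2$ let $\mathcal I_{\mathbb X}$ be the set of states of the form $\sum_i\lambda_i|x_i\rangle\langle x_i|$, and let $$C_g^{\mathbb X}(\rho)=1-\max_{\sigma\in\mathcal I_{\mathbb X}}F(\rho,\sigma),\qquad F(\rho,\sigma)=\Bigl(\operatorname{tr}\sqrt{\sqrt\rho\,\sigma\sqrt\rho}\Bigr)^2,$$ be the geometric coherence of $\rho$ with respect to $\mathbb X$. Let $\mathbb X,\mathbb Y,\mathbb Z$ be three orthonormal bases of $\mathbb C^2$, and let $\mathfrak c_1\ge\mathfrak c_2\ge\mathfrak c_3$ be the three numbers $\max_{i,j}|\langle x_i|y_j\rangle|^2$, $\max_{i,j}|\langle y_i|z_j\rangle|^2$, $\max_{i,j}|\langle x_i|z_j\rangle|^2$ arranged in descending order. Put $f(x)=\sqrt{1+4(2\mathcal P-1)(x^2-x)}$. (1) If $1+\sqrt{\mathfrak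 c_3}<\sqrt{\mathfrak c_1}+\sqrt{\mathfrak c_2}$, then $$C_g^{\mathbb X}(\rho)+C_g^{\mathbb Y}(\rho)+C_g^{\mathbb Z}(\rho)\ \ge\ 1-\tfrac12\bigl[f(\sqrt{\mathfrak c_1})+f(\sqrt{\mathfrak c_1}-\sqrt{\mathfrak c_3})\bigr].$$ (2) If $1+\sqrt{\mathfrak c_3}\ge\sqrt{\mathfrak c_1}+\sqrt{\mathfrak c_2}$, then $$C_g^{\mathbb X}(\rho)+C_g^{\mathbb Y}(\rho)+C_g^{\mathbb Z}(\rho)\ \ge\ \tfrac32-\tfrac12\max\Bigl\{1+f(\sqrt{\mathfrak c_1})+f(\sqrt{\mathfrak c_2}),\ f\bigl(\tfrac{1-\sqrt{\mathfrak c_1}-\sqrt{\mathfrak c_2}+\sqrt{\mathfrak c_3}}2\bigr)+f\bigl(\tfrac{1-\sqrt{\mathfrak c_1}+\sqrt{\mathfrak c_2}-\sqrt{\mathfrak c_3}}2\bigr)+f\bigl(\tfrac{1+\sqrt{\mathfrak c_1}-\sqrt{\mathfrak c_2}-\sqrt{\mathfrak c_3}}2\bigr)\Bigr\}.$$ -/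

import Mathlib

namespace GeomCoherence

open scoped ComplexOrder

noncomputable section

variable {d : ℕ}

/-- The `d`-dimensional Hilbert space. -/
abbrev Hilb (d : ℕ) : Type := EuclideanSpace ℂ (Fin d)

/-- A quantum state: a positive semidefinite matrix of trace one. -/
def IsState (ρ : Matrix (Fin d) (Fin d) ℂ) : Prop :=
  ρ.PosSemidef ∧ ρ.trace = 1

/-- The purity `tr (ρ ^ 2)`. -/
def purity (ρ : Matrix (Fin d) (Fin d) ℂ) : ℝ :=
  (ρ * ρ).trace.re

/-- The rank-one operator `|v⟩⟨v|`. -/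
def ketBra (v : Hilb d) : Matrix (Fin d) (Fin d) ℂ :=
  Matrix.of fun i j => v i * star (v j)

/-- The incoherent states of the orthonormal basis `X`: the quantum states of the form
`∑ i, l i |x i⟩⟨x i|`. -/
def incoherentStates (X : OrthonormalBasis (Fin d) ℂ (Hilb d)) :
    Set (Matrix (Fin d) (Fin d) ℂ) :=
  {σ | IsState σ ∧ ∃ l : Fin d → ℝ, σ = ∑ i, (l i : ℂ) • ketBra (X i)}

/-- The square root of a positive semidefinite matrix, through the functional calculus of
Hermitian matrices. -/
def msqrt (A : Matrix (Fin d) (Fin d) ℂ) : Matrix (Fin d) (Fin d) ℂ :=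
  cfc Real.sqrt A

/-- The fidelity `(tr √(√ρ σ √ρ)) ^ 2`. -/
def fidelity (ρ σ : Matrix (Fin d) (Fin d) ℂ) : ℝ :=
  (msqrt (msqrt ρ * σ * msqrt ρ)).trace.re ^ 2

/-- The geometric coherence `1 - max F(ρ, σ)`, with `σ` running over the incoherent states
of `X`. -/
def geomCoherence (X : OrthonormalBasis (Fin d) ℂ (Hilb d))
    (ρ : Matrix (Fin d) (Fin d) ℂ) : ℝ :=
  1 - sSup (fidelity ρ '' incoherentStates X)

/-- The incompatibility `max |⟨x i | y j⟩| ^ 2` of two orthonormal bases. -/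
def incompatibility (X Y : OrthonormalBasis (Fin d) ℂ (Hilb d)) : ℝ :=
  ⨆ p : Fin d × Fin d, ‖inner ℂ (X p.1) (Y p.2)‖ ^ 2

/-- The entries of a triple of real numbers rearranged in descending order
(`Tuple.sort` sorts in ascending order, `Fin.rev` reverses). -/
def sortDesc (v : Fin 3 → ℝ) : Fin 3 → ℝ :=
  fun i => v (Tuple.sort v (Fin.rev i))

/-- The incompatibility vector of three orthonormal bases, in descending order. -/
def incompatibilityVector (X Y Z : OrthonormalBasis (Fin d) ℂ (Hilb d)) : Fin 3 → ℝ :=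
  sortDesc ![incompatibility X Y, incompatibility Y Z, incompatibility X Z]

/-- The function `f(x) = √(1 + 4 (2P - 1) (x² - x))`. -/
def fP (P x : ℝ) : ℝ :=
  √(1 + 4 * (2 * P - 1) * (x ^ 2 - x))

end

end GeomCoherence

namespace GeomCoherence
open scoped ComplexOrder

/-! ### Fidelity of qubit states -/

/-! Write r for the Bloch vector of ρ, with ‖r‖² = 2P - 1, and x for the axis of a basis. The qubit
formula F = tr(ρσ) + 2√(det ρ det σ) and Cauchy–Schwarz bound the coherence below by (1 - √(1 - ‖r‖²
+ (r·x)²))/2, that is (1 - f((1 + a)/2))/2 with a = |r·x|/‖r‖ (`le_geomCoherence_of_overlap`). The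
three overlaps lie in [0, 1], and each pair has sum at most 2√c for the incompatibility c of its two
bases (`overlap_add_overlap_le`). What remains is to maximize g(a) + g(b) + g(c) on this polytope,
where g(t) = f((1 + t)/2) is convex and increasing for t ≥ 0. The candidates are the point where all
three pair constraints are tight and vertices with a coordinate equal to 1; whether the former lies
in the cube separates the two regimes (`sum_le_of_lt`, `sum_le_of_ge`). -/

lemma posSemidef_msqrt {d : ℕ} (A : Matrix (Fin d) (Fin d) ℂ) : (msqrt A).PosSemidef := by
  open scoped MatrixOrder in
  exact Matrix.nonneg_iff_posSemidef.1 (cfc_nonneg fun x _ => Real.sqrt_nonneg x)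

lemma msqrt_mul_msqrt {d : ℕ} {A : Matrix (Fin d) (Fin d) ℂ} (hA : A.PosSemidef) :
    msqrt A * msqrt A = A := by
  have hsp : ∀ x ∈ spectrum ℝ A, 0 ≤ x := by
    intro x hx
    rw [hA.isHermitian.spectrum_real_eq_range_eigenvalues] at hx
    obtain ⟨i, rfl⟩ := hx
    exact hA.eigenvalues_nonneg i
  have hsa : IsSelfAdjoint A := hA.isHermitian
  unfold msqrt
  rw [← cfc_mul Real.sqrt Real.sqrt A]
  have h : (spectrum ℝ A).EqOn (fun x => √x * √x) id := fun x hx => Real.mul_self_sqrt (hsp x hx)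
  rw [cfc_congr h]
  exact cfc_id ℝ A hsa

/-- The Bloch vector of a `2 × 2` matrix. -/
noncomputable def bloch (M : Matrix (Fin 2) (Fin 2) ℂ) : EuclideanSpace ℝ (Fin 3) :=
  !₂[2 * (M 0 1).re, 2 * (M 0 1).im, (M 0 0).re - (M 1 1).re]

lemma re_im_of_isHermitian {M : Matrix (Fin 2) (Fin 2) ℂ} (hM : M.IsHermitian) :
    (M 0 0).im = 0 ∧ (M 1 1).im = 0 ∧ (M 1 0).re = (M 0 1).re ∧ (M 1 0).im = -(M 0 1).im := by
  have h0 := congrArg Complex.im (hM.apply 0 0)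
  have h1 := congrArg Complex.im (hM.apply 1 1)
  have h2 := congrArg Complex.re (hM.apply 1 0)
  have h3 := congrArg Complex.im (hM.apply 1 0)
  simp at h0 h1 h2 h3
  refine ⟨by linarith, by linarith, by linarith, by linarith⟩

/-- Orthogonality of the Pauli matrices. The sign convention of the second Bloch coordinate is
immaterial, since only norms and inner products occur. -/
lemma two_mul_re_trace_mul {M N : Matrix (Fin 2) (Fin 2) ℂ} (hM : M.IsHermitian)
    (hN : N.IsHermitian) :
    2 * (M * N).trace.re = M.trace.re * N.trace.re + inner ℝ (bloch M) (bloch N) := by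
  obtain ⟨m0, m1, m2, m3⟩ := re_im_of_isHermitian hM
  obtain ⟨n0, n1, n2, n3⟩ := re_im_of_isHermitian hN
  simp [bloch, Matrix.trace, Matrix.mul_apply, Fin.sum_univ_two, Fin.sum_univ_three,
    PiLp.inner_apply, m0, m1, m2, m3, n0, n1, n2, n3]
  ring

lemma four_mul_re_det {M : Matrix (Fin 2) (Fin 2) ℂ} (hM : M.IsHermitian) :
    4 * M.det.re = M.trace.re ^ 2 - ‖bloch M‖ ^ 2 := by
  obtain ⟨m0, m1, m2, m3⟩ := re_im_of_isHermitian hM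
  rw [EuclideanSpace.norm_sq_eq]
  simp [bloch, Matrix.trace, Matrix.det_fin_two, Fin.sum_univ_two, Fin.sum_univ_three, m0, m1, m2, m3]
  ring

lemma bloch_add (M N : Matrix (Fin 2) (Fin 2) ℂ) : bloch (M + N) = bloch M + bloch N := by
  ext i; fin_cases i <;> simp [bloch] <;> ring

lemma bloch_smul (a : ℝ) (M : Matrix (Fin 2) (Fin 2) ℂ) :
    bloch ((a : ℂ) • M) = a • bloch M := by
  ext i; fin_cases i <;> simp [bloch] <;> ring

lemma bloch_one : bloch 1 = 0 := by
  ext i; fin_cases i <;> simp [bloch]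

/-- The fidelity of two qubit states is `tr (ρ σ) + 2 √(det ρ det σ)`. -/
lemma exists_fidelity_eq {ρ σ : Matrix (Fin 2) (Fin 2) ℂ} (hρ : ρ.PosSemidef)
    (hσ : σ.PosSemidef) :
    ∃ n : ℝ, n ^ 2 = ρ.det.re * σ.det.re ∧
      fidelity ρ σ = (ρ * σ).trace.re + 2 * n := by
  have hS := posSemidef_msqrt ρ
  have hSS := msqrt_mul_msqrt hρ
  set S := msqrt ρ with hSdef
  have hM : (S * σ * S).PosSemidef := by
    have := hσ.mul_mul_conjTranspose_same S
    rwa [hS.isHermitian.eq] at this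
  have hN := posSemidef_msqrt (S * σ * S)
  have hNN := msqrt_mul_msqrt hM
  set N := msqrt (S * σ * S) with hNdef
  have htr : (N * N).trace = (ρ * σ).trace := by
    rw [hNN, Matrix.mul_assoc, Matrix.trace_mul_comm, Matrix.mul_assoc, hSS,
      Matrix.trace_mul_comm]
  have hdet : N.det * N.det = ρ.det * σ.det := by
    rw [← Matrix.det_mul, hNN, ← hSS]
    simp only [Matrix.det_mul]
    ring
  have hdN := (Complex.nonneg_iff.1 hN.det_nonneg).2
  have hdρ := (Complex.nonneg_iff.1 hρ.det_nonneg).2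
  -- Only the square of the witness is needed later, so its sign is not recorded. The fidelity
  -- formula is (tr N)² = tr(N²) + 2 det N for a 2 × 2 matrix.
  refine ⟨N.det.re, ?_, ?_⟩
  · have := congrArg Complex.re hdet
    simp only [Complex.mul_re, ← hdN, ← hdρ] at this
    linarith
  · have h1 := two_mul_re_trace_mul hN.isHermitian hN.isHermitian
    have h2 := four_mul_re_det hN.isHermitian
    rw [real_inner_self_eq_norm_sq] at h1
    unfold fidelity
    rw [← hSdef, ← hNdef, ← htr]
    linarith

/-! ### Bloch vectors of orthonormal bases and of states -/

lemma isHermitian_ketBra {d : ℕ} (v : Hilb d) : (ketBra v).IsHermitian := by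
  ext i j
  simp [ketBra, mul_comm]

lemma re_trace_ketBra {d : ℕ} (v : Hilb d) : (ketBra v).trace.re = ‖v‖ ^ 2 := by
  simp [ketBra, Matrix.trace, EuclideanSpace.norm_sq_eq, Complex.mul_conj,
    Complex.normSq_eq_norm_sq, -Complex.ofReal_pow]

lemma re_trace_ketBra_mul_ketBra {d : ℕ} (v w : Hilb d) :
    (ketBra v * ketBra w).trace.re = ‖inner ℂ v w‖ ^ 2 := by
  have h : (ketBra v * ketBra w).trace = inner ℂ v w * inner ℂ w v := by
    simp only [ketBra, Matrix.trace, Matrix.diag, Matrix.mul_apply, Matrix.of_apply,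
      PiLp.inner_apply, RCLike.inner_apply, Finset.sum_mul_sum]
    rw [Finset.sum_comm]
    refine Finset.sum_congr rfl fun i _ => Finset.sum_congr rfl fun j _ => ?_
    simp
    ring
  rw [h, ← inner_conj_symm w v, Complex.mul_conj, Complex.normSq_eq_norm_sq,
    Complex.ofReal_re]

lemma sum_ketBra {d : ℕ} (X : OrthonormalBasis (Fin d) ℂ (Hilb d)) :
    ∑ i, ketBra (X i) = 1 := by
  ext a b
  have h := X.sum_repr' (EuclideanSpace.single b (1 : ℂ))
  have h := congrArg (fun v : Hilb d => v a) h
  simp [EuclideanSpace.inner_single_right, Finset.sum_apply] at h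
  simp [ketBra, Matrix.sum_apply, Matrix.one_apply] at h ⊢
  rw [← h]
  exact Finset.sum_congr rfl fun i _ => mul_comm _ _

/-- The Bloch vector of the first element of an orthonormal basis. -/
noncomputable def axis (X : OrthonormalBasis (Fin 2) ℂ (Hilb 2)) : EuclideanSpace ℝ (Fin 3) :=
  bloch (ketBra (X 0))

lemma two_mul_norm_inner_sq {v w : Hilb 2} (hv : ‖v‖ = 1) (hw : ‖w‖ = 1) :
    2 * ‖inner ℂ v w‖ ^ 2 = 1 + inner ℝ (bloch (ketBra v)) (bloch (ketBra w)) := by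
  rw [← re_trace_ketBra_mul_ketBra, two_mul_re_trace_mul (isHermitian_ketBra v)
    (isHermitian_ketBra w), re_trace_ketBra, re_trace_ketBra, hv, hw]
  ring

lemma norm_axis (X : OrthonormalBasis (Fin 2) ℂ (Hilb 2)) : ‖axis X‖ = 1 := by
  have h := two_mul_norm_inner_sq (X.norm_eq_one 0) (X.norm_eq_one 0)
  rw [inner_self_eq_norm_sq_to_K, X.norm_eq_one 0, real_inner_self_eq_norm_sq] at h
  norm_num at h
  have h' : ‖axis X‖ ^ 2 = 1 := by unfold axis; linarith
  nlinarith [norm_nonneg (axis X)]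

lemma bloch_ketBra_one (X : OrthonormalBasis (Fin 2) ℂ (Hilb 2)) :
    bloch (ketBra (X 1)) = -axis X := by
  have h := congrArg bloch (sum_ketBra X)
  rw [Fin.sum_univ_two, bloch_add, bloch_one] at h
  exact eq_neg_of_add_eq_zero_right h

/-- The two vectors of `Y` have opposite Bloch vectors, so their transition probabilities from `X 0`
are (1 ± x·y)/2. -/
lemma one_add_abs_inner_axis_le (X Y : OrthonormalBasis (Fin 2) ℂ (Hilb 2)) :
    1 + |inner ℝ (axis X) (axis Y)| ≤ 2 * incompatibility X Y := by
  have hb : BddAbove (Set.range fun p : Fin 2 × Fin 2 => ‖inner ℂ (X p.1) (Y p.2)‖ ^ 2) :=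
    Set.finite_range _ |>.bddAbove
  have h0 := le_ciSup hb (0, 0)
  have h1 := le_ciSup hb (0, 1)
  have e0 := two_mul_norm_inner_sq (X.norm_eq_one 0) (Y.norm_eq_one 0)
  have e1 := two_mul_norm_inner_sq (X.norm_eq_one 0) (Y.norm_eq_one 1)
  rw [bloch_ketBra_one, inner_neg_right] at e1
  change _ = 1 + inner ℝ (axis X) (axis Y) at e0
  change _ = 1 + -inner ℝ (axis X) (axis Y) at e1
  change _ ≤ incompatibility X Y at h0 h1
  dsimp only at h0 h1
  rcases abs_cases (inner ℝ (axis X) (axis Y)) with ⟨h, _⟩ | ⟨h, _⟩ <;> rw [h] <;> linarith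

lemma incompatibility_le_one (X Y : OrthonormalBasis (Fin 2) ℂ (Hilb 2)) :
    incompatibility X Y ≤ 1 := by
  refine ciSup_le fun p => ?_
  have h := norm_inner_le_norm (𝕜 := ℂ) (X p.1) (Y p.2)
  rw [X.norm_eq_one, Y.norm_eq_one, one_mul] at h
  exact pow_le_one₀ (norm_nonneg _) h

lemma norm_bloch_sq {ρ : Matrix (Fin 2) (Fin 2) ℂ} (hρ : IsState ρ) :
    ‖bloch ρ‖ ^ 2 = 2 * purity ρ - 1 := by
  have h := two_mul_re_trace_mul hρ.1.isHermitian hρ.1.isHermitian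
  rw [hρ.2, real_inner_self_eq_norm_sq] at h
  simp only [Complex.one_re] at h
  unfold purity
  linarith

lemma norm_bloch_sq_le_one {ρ : Matrix (Fin 2) (Fin 2) ℂ} (hρ : IsState ρ) :
    ‖bloch ρ‖ ^ 2 ≤ 1 := by
  have h := four_mul_re_det hρ.1.isHermitian
  rw [hρ.2, Complex.one_re] at h
  have := (Complex.nonneg_iff.1 hρ.1.det_nonneg).1
  linarith

/-! ### Lower bound on the geometric coherence -/

/-- With u·x the Bloch vector of σ and s = r·x, F = (1 + us + 4n)/2 where 16n² = (1 - ‖r‖²)(1 - u²).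
The bound is Cauchy–Schwarz for (u, √(1 - u²)) and (s, √(1 - ‖r‖²)). -/
lemma fidelity_le_of_mem_incoherentStates {ρ σ : Matrix (Fin 2) (Fin 2) ℂ} (hρ : IsState ρ)
    {X : OrthonormalBasis (Fin 2) ℂ (Hilb 2)} (hσ : σ ∈ incoherentStates X) :
    fidelity ρ σ ≤
      (1 + √(1 - ‖bloch ρ‖ ^ 2 + inner ℝ (bloch ρ) (axis X) ^ 2)) / 2 := by
  obtain ⟨hσ, l, hl⟩ := hσ
  obtain ⟨n, hn, hF⟩ := exists_fidelity_eq hρ.1 hσ.1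
  have hb : bloch σ = (l 0 - l 1) • axis X := by
    rw [hl, Fin.sum_univ_two, bloch_add, bloch_smul, bloch_smul, bloch_ketBra_one, axis]
    module
  have htr := two_mul_re_trace_mul hρ.1.isHermitian hσ.1.isHermitian
  have hdρ := four_mul_re_det hρ.1.isHermitian
  have hdσ := four_mul_re_det hσ.1.isHermitian
  have hD := (Complex.nonneg_iff.1 hρ.1.det_nonneg).1
  have hE := (Complex.nonneg_iff.1 hσ.1.det_nonneg).1
  rw [hρ.2, hσ.2, hb, inner_smul_right, Complex.one_re] at htr
  rw [hρ.2, Complex.one_re] at hdρ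
  rw [hσ.2, hb, norm_smul, norm_axis, Complex.one_re, mul_one, Real.norm_eq_abs, sq_abs] at hdσ
  set u := l 0 - l 1
  set s : ℝ := inner ℝ (bloch ρ) (axis X)
  set D := ρ.det.re
  set E := σ.det.re
  have key : u * s + 4 * n ≤ √(1 - ‖bloch ρ‖ ^ 2 + s ^ 2) := by
    apply Real.le_sqrt_of_sq_le
    have hP : 0 ≤ 4 * E * s ^ 2 := by positivity
    have hQ : 0 ≤ 4 * D * u ^ 2 := by positivity
    -- The cross term, squared, is 4pq with p = 4Es² and q = 4Du², hence at most (p + q)².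
    have h1 : (8 * u * s * n) ^ 2 ≤ (4 * E * s ^ 2 + 4 * D * u ^ 2) ^ 2 := by
      have : (8 * u * s * n) ^ 2 = 4 * (4 * E * s ^ 2) * (4 * D * u ^ 2) := by
        calc _ = 64 * u ^ 2 * s ^ 2 * n ^ 2 := by ring
          _ = _ := by rw [hn]; ring
      rw [this]
      nlinarith [sq_nonneg (4 * E * s ^ 2 - 4 * D * u ^ 2)]
    have h2 := le_trans (le_abs_self _) (abs_le_of_sq_le_sq h1 (by positivity))
    have h3 : u ^ 2 = 1 - 4 * E := by linarith
    calc (u * s + 4 * n) ^ 2 = u ^ 2 * s ^ 2 + 8 * u * s * n + 16 * n ^ 2 := by ring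
      _ ≤ u ^ 2 * s ^ 2 + (4 * E * s ^ 2 + 4 * D * u ^ 2) + 16 * (D * E) := by
        rw [hn]; linarith
      _ = 1 - ‖bloch ρ‖ ^ 2 + s ^ 2 := by rw [h3, ← one_pow 2, ← hdρ]; ring
  rw [hF]
  linarith

lemma le_geomCoherence {ρ : Matrix (Fin 2) (Fin 2) ℂ} (hρ : IsState ρ)
    (X : OrthonormalBasis (Fin 2) ℂ (Hilb 2)) :
    (1 - √(1 - ‖bloch ρ‖ ^ 2 + inner ℝ (bloch ρ) (axis X) ^ 2)) / 2 ≤ geomCoherence X ρ := by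
  have h : sSup (fidelity ρ '' incoherentStates X) ≤
      (1 + √(1 - ‖bloch ρ‖ ^ 2 + inner ℝ (bloch ρ) (axis X) ^ 2)) / 2 := by
    -- An upper bound on the supremum suffices, so attainment is not needed; nonnegativity of the
    -- bound covers the convention `sSup ∅ = 0`.
    apply Real.sSup_le
    · rintro _ ⟨σ, hσ, rfl⟩
      exact fidelity_le_of_mem_incoherentStates hρ hσ
    · positivity
  unfold geomCoherence
  linarith

/-- The left side is r·(±x ± y) for suitable signs, and ‖x ± y‖² = 2 ± 2 x·y ≤ 4c. -/
lemma abs_inner_add_abs_inner_le (ρ : Matrix (Fin 2) (Fin 2) ℂ)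
    (X Y : OrthonormalBasis (Fin 2) ℂ (Hilb 2)) :
    |inner ℝ (bloch ρ) (axis X)| + |inner ℝ (bloch ρ) (axis Y)| ≤
      ‖bloch ρ‖ * (2 * √(incompatibility X Y)) := by
  have hc := one_add_abs_inner_axis_le X Y
  have hx := norm_axis X
  have hy := norm_axis Y
  set r := bloch ρ
  set x := axis X
  set y := axis Y
  have h4 : 2 * √(incompatibility X Y) = √(4 * incompatibility X Y) := by
    rw [Real.sqrt_mul (by norm_num), show (4 : ℝ) = 2 ^ 2 by norm_num,
      Real.sqrt_sq (by norm_num)]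
  have hadd : ‖x + y‖ ≤ 2 * √(incompatibility X Y) := by
    rw [h4]
    apply Real.le_sqrt_of_sq_le
    rw [norm_add_sq_real, hx, hy]
    linarith [le_abs_self (inner ℝ x y)]
  have hsub : ‖x - y‖ ≤ 2 * √(incompatibility X Y) := by
    rw [h4]
    apply Real.le_sqrt_of_sq_le
    rw [norm_sub_sq_real, hx, hy]
    linarith [neg_abs_le (inner ℝ x y)]
  have h1 := (abs_real_inner_le_norm r (x + y)).trans
    (mul_le_mul_of_nonneg_left hadd (norm_nonneg r))
  have h2 := (abs_real_inner_le_norm r (x - y)).trans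
    (mul_le_mul_of_nonneg_left hsub (norm_nonneg r))
  rw [inner_add_right] at h1
  rw [inner_sub_right] at h2
  rw [abs_le] at h1 h2
  rcases abs_cases (inner ℝ r x) with ⟨h, _⟩ | ⟨h, _⟩ <;>
  rcases abs_cases (inner ℝ r y) with ⟨h', _⟩ | ⟨h', _⟩ <;> rw [h, h'] <;> linarith


/-! ### Maximization of a convex even function over pairwise constraints -/

section Optimization

variable {g : ℝ → ℝ}

lemma convexOn_comp_const_sub (hg : ConvexOn ℝ Set.univ g) (m : ℝ) :
    ConvexOn ℝ Set.univ fun t => g (m - t) := by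
  exact hg.comp_affineMap (AffineMap.const ℝ ℝ m - AffineMap.id ℝ ℝ)

lemma le_max_of_convexOn {h : ℝ → ℝ} (hh : ConvexOn ℝ Set.univ h) {a b t : ℝ} (hat : a ≤ t)
    (htb : t ≤ b) : h t ≤ max (h a) (h b) :=
  hh.le_max_of_mem_Icc (Set.mem_univ a) (Set.mem_univ b) ⟨hat, htb⟩

/-- The function t ↦ g(t) + g(m - t) is convex and takes the same value at both ends of [m - a, a].
-/
lemma add_sub_le_of_convexOn (hg : ConvexOn ℝ Set.univ g) {a m b : ℝ} (h₁ : m - a ≤ b)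
    (h₂ : b ≤ a) : g b + g (m - b) ≤ g a + g (m - a) := by
  have h := le_max_of_convexOn (hg.add (convexOn_comp_const_sub hg m)) h₁ h₂
  simp only [Pi.add_apply, sub_sub_cancel] at h
  rwa [add_comm (g (m - a)), max_self] at h

/-- Monotonicity pushes b and c up to A - a and C - a; the result is convex in a, so an endpoint of
[s, 1] is at least as good. -/
lemma sum_le_max_of_segment (hg : ConvexOn ℝ Set.univ g) (hm : MonotoneOn g (Set.Ici 0))
    {a b c s A C : ℝ} (hb : 0 ≤ b) (hc : 0 ≤ c) (hsa : s ≤ a) (ha1 : a ≤ 1)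
    (hab : a + b ≤ A) (hac : a + c ≤ C) :
    g a + g b + g c ≤ max (g s + g (A - s) + g (C - s)) (g 1 + g (A - 1) + g (C - 1)) := by
  have h := le_max_of_convexOn
    ((hg.add (convexOn_comp_const_sub hg A)).add (convexOn_comp_const_sub hg C)) hsa ha1
  simp only [Pi.add_apply] at h
  have h1 : g b ≤ g (A - a) := hm hb (hb.trans (by linarith)) (by linarith)
  have h2 : g c ≤ g (C - a) := hm hc (hc.trans (by linarith)) (by linarith)
  linarith

/-- Here (A + C - B)/2 > 1, so the point with all pair constraints tight leaves the cube, and (1, A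
- 1, B - A + 1) is the optimal vertex. -/
lemma sum_le_of_lt (hg : ConvexOn ℝ Set.univ g) (hm : MonotoneOn g (Set.Ici 0))
    {a b c A B C : ℝ} (ha : 0 ≤ a) (hb : 0 ≤ b) (hc : 0 ≤ c) (ha1 : a ≤ 1) (hb1 : b ≤ 1)
    (hc1 : c ≤ 1) (hab : a + b ≤ A) (hac : a + c ≤ C) (hbc : b + c ≤ B) (hB : 1 ≤ B)
    (hCA : C ≤ A) (hA : A ≤ 2) (h : 2 + B < A + C) :
    g a + g b + g c ≤ g 1 + g (A - 1) + g (B - A + 1) := by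
  have hBg : g (B - 1) ≤ g (B - A + 1) :=
    hm (by simpa using hB) (by simp only [Set.mem_Ici]; linarith) (by linarith)
  have hCg : g (C - 1) ≤ g (A - 1) :=
    hm (by simp only [Set.mem_Ici]; linarith) (by simp only [Set.mem_Ici]; linarith)
      (by linarith)
  have hag : g a ≤ g 1 := hm ha (Set.mem_Ici.2 zero_le_one) ha1
  by_cases h1 : A - 1 ≤ b
  · have := sum_le_max_of_segment hg hm ha hc h1 hb1 (by linarith : b + a ≤ A) hbc
    rw [sub_sub_cancel, show B - (A - 1) = B - A + 1 by ring] at this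
    refine (by linarith : g a + g b + g c ≤ _).trans (this.trans (max_le ?_ ?_)) <;> linarith
  by_cases h2 : C - 1 ≤ c
  · have := sum_le_max_of_segment hg hm ha hb h2 hc1 (by linarith : c + a ≤ C)
      (by linarith : c + b ≤ B)
    rw [sub_sub_cancel] at this
    have h3 := add_sub_le_of_convexOn hg (a := A - 1) (m := B) (b := C - 1) (by linarith)
      (by linarith)
    rw [show B - (A - 1) = B - A + 1 by ring] at h3
    refine (by linarith : g a + g b + g c ≤ _).trans (this.trans (max_le ?_ ?_)) <;> linarith
  push Not at h1 h2
  -- With b < A - 1 and c < C - 1, a may be replaced by 1; only b + c ≤ B still matters, and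
  -- convexity spreads b and c apart.
  by_cases h3 : B - (A - 1) ≤ b
  · have h4 := add_sub_le_of_convexOn hg (a := A - 1) (m := B) h3 h1.le
    rw [show B - (A - 1) = B - A + 1 by ring] at h4
    have h5 : g c ≤ g (B - b) := hm hc (hc.trans (by linarith)) (by linarith)
    linarith
  · have h4 : g b ≤ g (B - A + 1) := hm hb (hb.trans (by linarith)) (by linarith)
    have h5 : g c ≤ g (A - 1) := hm hc (hc.trans (by linarith)) (by linarith)
    linarith

/-- Let v be the point with all pair constraints tight. If some coordinate is at least that of v,
slide it along the segment from v to 1; the end with a = 1 dominates the other two by the ordering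
of A, B, C. Otherwise v dominates coordinatewise. -/
lemma sum_le_of_ge (hg : ConvexOn ℝ Set.univ g) (hm : MonotoneOn g (Set.Ici 0))
    {a b c A B C : ℝ} (ha : 0 ≤ a) (hb : 0 ≤ b) (hc : 0 ≤ c) (ha1 : a ≤ 1) (hb1 : b ≤ 1)
    (hc1 : c ≤ 1) (hab : a + b ≤ A) (hac : a + c ≤ C) (hbc : b + c ≤ B) (hB : 1 ≤ B)
    (hBC : B ≤ C) (hCA : C ≤ A) :
    g a + g b + g c ≤ max (g 1 + g (A - 1) + g (C - 1))
      (g ((A + C - B) / 2) + g ((A + B - C) / 2) + g ((B + C - A) / 2)) := by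
  have hBg : g (B - 1) ≤ g (C - 1) :=
    hm (by simpa using hB) (by simp only [Set.mem_Ici]; linarith) (by linarith)
  have hCg : g (C - 1) ≤ g (A - 1) :=
    hm (by simp only [Set.mem_Ici]; linarith) (by simp only [Set.mem_Ici]; linarith)
      (by linarith)
  by_cases h1 : (A + C - B) / 2 ≤ a
  · have := sum_le_max_of_segment hg hm hb hc h1 ha1 hab hac
    rw [show A - (A + C - B) / 2 = (A + B - C) / 2 by ring,
      show C - (A + C - B) / 2 = (B + C - A) / 2 by ring] at this
    rwa [max_comm]
  by_cases h2 : (A + B - C) / 2 ≤ b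
  · have := sum_le_max_of_segment hg hm ha hc h2 hb1 (by linarith : b + a ≤ A) hbc
    rw [show A - (A + B - C) / 2 = (A + C - B) / 2 by ring,
      show B - (A + B - C) / 2 = (B + C - A) / 2 by ring, max_comm] at this
    refine (by linarith : g a + g b + g c ≤ _).trans (this.trans (max_le_max ?_ ?_)) <;> linarith
  by_cases h3 : (B + C - A) / 2 ≤ c
  · have := sum_le_max_of_segment hg hm ha hb h3 hc1 (by linarith : c + a ≤ C)
      (by linarith : c + b ≤ B)
    rw [show C - (B + C - A) / 2 = (A + C - B) / 2 by ring,
      show B - (B + C - A) / 2 = (A + B - C) / 2 by ring, max_comm] at this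
    refine (by linarith : g a + g b + g c ≤ _).trans (this.trans (max_le_max ?_ ?_)) <;> linarith
  push Not at h1 h2 h3
  refine le_max_of_le_right (add_le_add (add_le_add ?_ ?_) ?_)
  · exact hm ha (ha.trans h1.le) h1.le
  · exact hm hb (hb.trans h2.le) h2.le
  · exact hm hc (hc.trans h3.le) h3.le

end Optimization

/-! ### The function `fP` -/

lemma fP_eq (P t : ℝ) : fP P ((1 + t) / 2) = √(1 - (2 * P - 1) + (2 * P - 1) * t ^ 2) := by
  unfold fP
  congr 1
  ring

lemma fP_one_sub (P x : ℝ) : fP P (1 - x) = fP P x := by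
  unfold fP
  congr 2
  ring

lemma fP_one (P : ℝ) : fP P 1 = 1 := by simp [fP]

lemma monotoneOn_fP {P : ℝ} (h0 : 0 ≤ 2 * P - 1) :
    MonotoneOn (fun t => fP P ((1 + t) / 2)) (Set.Ici 0) := by
  intro s hs t _ hst
  simp only [fP_eq]
  have hs : (0 : ℝ) ≤ s := hs
  gcongr

/-- With p = 2P - 1, the function is the norm of the affine path √(1 - p) + t√p·i in ℂ. -/
lemma convexOn_fP {P : ℝ} (h0 : 0 ≤ 2 * P - 1) (h1 : 2 * P - 1 ≤ 1) :
    ConvexOn ℝ Set.univ fun t => fP P ((1 + t) / 2) := by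
  have h : (fun t => fP P ((1 + t) / 2)) =
      (norm : ℂ → ℝ) ∘ AffineMap.lineMap (√(1 - (2 * P - 1)) : ℂ)
        (√(1 - (2 * P - 1)) + √(2 * P - 1) * Complex.I) := by
    ext t
    rw [fP_eq, Function.comp_apply, AffineMap.lineMap_apply]
    have : t • ((√(1 - (2 * P - 1)) + √(2 * P - 1) * Complex.I : ℂ) -ᵥ
        (√(1 - (2 * P - 1)) : ℂ)) +ᵥ (√(1 - (2 * P - 1)) : ℂ) =
        (√(1 - (2 * P - 1)) : ℝ) + (t * √(2 * P - 1) : ℝ) * Complex.I := by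
      simp
      ring
    rw [this, Complex.norm_add_mul_I, mul_pow, Real.sq_sqrt (sub_nonneg.2 h1), Real.sq_sqrt h0]
    congr 1
    ring
  rw [h]
  simpa using (convexOn_univ_norm (E := ℂ)).comp_affineMap (AffineMap.lineMap _ _ : ℝ →ᵃ[ℝ] ℂ)

/-- The bound for the sum of three values of `fP` at points subject to pairwise constraints,
the constraint constants being sorted. -/
lemma sum_fP_le {P a b c c₁ c₂ c₃ : ℝ} (h0 : 0 ≤ 2 * P - 1) (h1 : 2 * P - 1 ≤ 1)
    (ha : 0 ≤ a) (hb : 0 ≤ b) (hc : 0 ≤ c) (ha1 : a ≤ 1) (hb1 : b ≤ 1) (hc1 : c ≤ 1)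
    (hab : a + b ≤ 2 * √c₁) (hac : a + c ≤ 2 * √c₂) (hbc : b + c ≤ 2 * √c₃)
    (h₃ : 1 / 2 ≤ c₃) (h₃₂ : c₃ ≤ c₂) (h₂₁ : c₂ ≤ c₁) (h₁ : c₁ ≤ 1) :
    (1 + √c₃ < √c₁ + √c₂ →
      fP P ((1 + a) / 2) + fP P ((1 + b) / 2) + fP P ((1 + c) / 2) ≤
        1 + fP P (√c₁) + fP P (√c₁ - √c₃)) ∧
    (1 + √c₃ ≥ √c₁ + √c₂ →
      fP P ((1 + a) / 2) + fP P ((1 + b) / 2) + fP P ((1 + c) / 2) ≤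
        max (1 + fP P (√c₁) + fP P (√c₂))
            (fP P ((1 - √c₁ - √c₂ + √c₃) / 2) + fP P ((1 - √c₁ + √c₂ - √c₃) / 2)
              + fP P ((1 + √c₁ - √c₂ - √c₃) / 2))) := by
  have hg := convexOn_fP h0 h1
  have hm := monotoneOn_fP h0
  have s3 : 1 ≤ 2 * √c₃ := by
    have : 1 / 2 ≤ √c₃ := Real.le_sqrt_of_sq_le (by linarith)
    linarith
  have s32 := Real.sqrt_le_sqrt h₃₂
  have s21 := Real.sqrt_le_sqrt h₂₁
  have s1 : √c₁ ≤ 1 := Real.sqrt_le_one.2 h₁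
  have e1 : fP P ((1 + 1) / 2) = 1 := by norm_num [fP_one]
  constructor
  · intro h
    have := sum_le_of_lt hg hm ha hb hc ha1 hb1 hc1 hab hac hbc s3 (by linarith)
      (by linarith) (by linarith)
    -- The symmetry f(1 - x) = f(x) turns the arguments (1 + t)/2 into those of the statement.
    rwa [e1, show (1 + (2 * √c₁ - 1)) / 2 = √c₁ by ring,
      show (1 + (2 * √c₃ - 2 * √c₁ + 1)) / 2 = 1 - (√c₁ - √c₃) by ring, fP_one_sub] at this
  · intro _
    have := sum_le_of_ge hg hm ha hb hc ha1 hb1 hc1 hab hac hbc s3 (by linarith) (by linarith)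
    rwa [e1, show (1 + (2 * √c₁ - 1)) / 2 = √c₁ by ring,
      show (1 + (2 * √c₂ - 1)) / 2 = √c₂ by ring,
      show (1 + (2 * √c₁ + 2 * √c₂ - 2 * √c₃) / 2) / 2 = 1 - (1 - √c₁ - √c₂ + √c₃) / 2 by ring,
      show (1 + (2 * √c₁ + 2 * √c₃ - 2 * √c₂) / 2) / 2 = 1 - (1 - √c₁ + √c₂ - √c₃) / 2 by ring,
      show (1 + (2 * √c₃ + 2 * √c₂ - 2 * √c₁) / 2) / 2 = 1 - (1 + √c₁ - √c₂ - √c₃) / 2 by ring,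
      fP_one_sub, fP_one_sub, fP_one_sub] at this


/-! ### The incompatibility vector -/

lemma exists_perm_of_sortDesc_eq {v : Fin 3 → ℝ} {c₁ c₂ c₃ : ℝ}
    (h : sortDesc v = ![c₁, c₂, c₃]) :
    c₂ ≤ c₁ ∧ c₃ ≤ c₂ ∧ ∃ e : Equiv.Perm (Fin 3), v (e 0) = c₁ ∧ v (e 1) = c₂ ∧ v (e 2) = c₃ := by
  have h0 : v (Tuple.sort v 2) = c₁ := congrFun h 0
  have h1 : v (Tuple.sort v 1) = c₂ := congrFun h 1
  have h2 : v (Tuple.sort v 0) = c₃ := congrFun h 2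
  have hm := Tuple.monotone_sort v
  refine ⟨?_, ?_, Fin.revPerm.trans (Tuple.sort v), h0, h1, h2⟩
  · rw [← h0, ← h1]
    exact hm (by decide : (1 : Fin 3) ≤ 2)
  · rw [← h1, ← h2]
    exact hm (by decide : (0 : Fin 3) ≤ 1)

lemma perm_fin_three_values (e : Equiv.Perm (Fin 3)) :
    (e 0 = 0 ∧ e 1 = 1 ∧ e 2 = 2) ∨ (e 0 = 0 ∧ e 1 = 2 ∧ e 2 = 1) ∨
    (e 0 = 1 ∧ e 1 = 0 ∧ e 2 = 2) ∨ (e 0 = 1 ∧ e 1 = 2 ∧ e 2 = 0) ∨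
    (e 0 = 2 ∧ e 1 = 0 ∧ e 2 = 1) ∨ (e 0 = 2 ∧ e 1 = 1 ∧ e 2 = 0) := by
  revert e
  decide

lemma half_le_incompatibility (X Y : OrthonormalBasis (Fin 2) ℂ (Hilb 2)) :
    1 / 2 ≤ incompatibility X Y := by
  linarith [one_add_abs_inner_axis_le X Y, abs_nonneg (inner ℝ (axis X) (axis Y))]

/-! ### The normalized overlap of a state with an axis -/

/-- The absolute cosine of the angle between the Bloch vector of `ρ` and the axis of `X`. -/
noncomputable def overlap (ρ : Matrix (Fin 2) (Fin 2) ℂ)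
    (X : OrthonormalBasis (Fin 2) ℂ (Hilb 2)) : ℝ :=
  |inner ℝ (bloch ρ) (axis X)| / ‖bloch ρ‖

lemma overlap_nonneg (ρ : Matrix (Fin 2) (Fin 2) ℂ) (X : OrthonormalBasis (Fin 2) ℂ (Hilb 2)) :
    0 ≤ overlap ρ X := by
  unfold overlap
  positivity

lemma overlap_le_one (ρ : Matrix (Fin 2) (Fin 2) ℂ) (X : OrthonormalBasis (Fin 2) ℂ (Hilb 2)) :
    overlap ρ X ≤ 1 := by
  refine div_le_one_of_le₀ ?_ (norm_nonneg _)
  simpa [norm_axis] using abs_real_inner_le_norm (bloch ρ) (axis X)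

lemma overlap_add_overlap_le (ρ : Matrix (Fin 2) (Fin 2) ℂ)
    (X Y : OrthonormalBasis (Fin 2) ℂ (Hilb 2)) :
    overlap ρ X + overlap ρ Y ≤ 2 * √(incompatibility X Y) := by
  unfold overlap
  rw [← add_div]
  refine div_le_of_le_mul₀ (norm_nonneg _) (by positivity) ?_
  rw [mul_comm]
  exact abs_inner_add_abs_inner_le ρ X Y

lemma le_geomCoherence_of_overlap {ρ : Matrix (Fin 2) (Fin 2) ℂ} (hρ : IsState ρ)
    (X : OrthonormalBasis (Fin 2) ℂ (Hilb 2)) :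
    (1 - fP (purity ρ) ((1 + overlap ρ X) / 2)) / 2 ≤ geomCoherence X ρ := by
  have h : ‖bloch ρ‖ ^ 2 * overlap ρ X ^ 2 = inner ℝ (bloch ρ) (axis X) ^ 2 := by
    rw [overlap, ← mul_pow, mul_comm, div_mul_cancel_of_imp, sq_abs]
    -- For the maximally mixed state r = 0, the numerator of the overlap vanishes together with the
    -- denominator.
    intro h
    rw [norm_eq_zero.1 h, inner_zero_left, abs_zero]
  rw [fP_eq, ← norm_bloch_sq hρ, h]
  exact le_geomCoherence hρ X

end GeomCoherence

open GeomCoherence in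
theorem theorem3 (ρ : Matrix (Fin 2) (Fin 2) ℂ) (hρ : GeomCoherence.IsState ρ)
    (X Y Z : OrthonormalBasis (Fin 2) ℂ (EuclideanSpace ℂ (Fin 2)))
    (c₁ c₂ c₃ : ℝ)
    (hc : GeomCoherence.incompatibilityVector X Y Z = ![c₁, c₂, c₃])
    (f : ℝ → ℝ) (hf : f = GeomCoherence.fP (GeomCoherence.purity ρ)) :
    (1 + √c₃ < √c₁ + √c₂ →
      GeomCoherence.geomCoherence X ρ + GeomCoherence.geomCoherence Y ρ
          + GeomCoherence.geomCoherence Z ρ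
        ≥ 1 - 1 / 2 * (f (√c₁) + f (√c₁ - √c₃))) ∧
    (1 + √c₃ ≥ √c₁ + √c₂ →
      GeomCoherence.geomCoherence X ρ + GeomCoherence.geomCoherence Y ρ
          + GeomCoherence.geomCoherence Z ρ
        ≥ 3 / 2 - 1 / 2 * max (1 + f (√c₁) + f (√c₂))
            (f ((1 - √c₁ - √c₂ + √c₃) / 2) + f ((1 - √c₁ + √c₂ - √c₃) / 2)
              + f ((1 + √c₁ - √c₂ - √c₃) / 2))) := by
  subst hf
  have h0 : 0 ≤ 2 * purity ρ - 1 := norm_bloch_sq hρ ▸ sq_nonneg _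
  have h1 : 2 * purity ρ - 1 ≤ 1 := norm_bloch_sq hρ ▸ norm_bloch_sq_le_one hρ
  have gX := le_geomCoherence_of_overlap hρ X
  have gY := le_geomCoherence_of_overlap hρ Y
  have gZ := le_geomCoherence_of_overlap hρ Z
  have x0 := overlap_nonneg ρ X
  have y0 := overlap_nonneg ρ Y
  have z0 := overlap_nonneg ρ Z
  have x1 := overlap_le_one ρ X
  have y1 := overlap_le_one ρ Y
  have z1 := overlap_le_one ρ Z
  have xy := overlap_add_overlap_le ρ X Y
  have yz := overlap_add_overlap_le ρ Y Z
  have xz := overlap_add_overlap_le ρ X Z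
  have yx := add_comm (overlap ρ X) (overlap ρ Y) ▸ xy
  have zy := add_comm (overlap ρ Y) (overlap ρ Z) ▸ yz
  have zx := add_comm (overlap ρ X) (overlap ρ Z) ▸ xz
  have lXY := half_le_incompatibility X Y
  have lYZ := half_le_incompatibility Y Z
  have lXZ := half_le_incompatibility X Z
  have uXY := incompatibility_le_one X Y
  have uYZ := incompatibility_le_one Y Z
  have uXZ := incompatibility_le_one X Z
  obtain ⟨h21, h32, e, e0, e1, e2⟩ := exists_perm_of_sortDesc_eq hc
  -- In each ordering, a must belong to the basis shared by the pairs of c₁ and c₂, b to the one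
  -- shared by c₁ and c₃, and c to the one shared by c₂ and c₃.
  have key : ∀ {a b c : ℝ}, 0 ≤ a → 0 ≤ b → 0 ≤ c → a ≤ 1 → b ≤ 1 → c ≤ 1 →
      a + b ≤ 2 * √c₁ → a + c ≤ 2 * √c₂ → b + c ≤ 2 * √c₃ → 1 / 2 ≤ c₃ → c₁ ≤ 1 → _ :=
    fun ha hb hc ha1 hb1 hc1 hab hac hbc h₃ h₁ =>
      sum_fP_le h0 h1 ha hb hc ha1 hb1 hc1 hab hac hbc h₃ h32 h21 h₁
  rcases perm_fin_three_values e with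
    ⟨i, j, k⟩ | ⟨i, j, k⟩ | ⟨i, j, k⟩ | ⟨i, j, k⟩ | ⟨i, j, k⟩ | ⟨i, j, k⟩ <;>
  simp only [i, j, k, Matrix.cons_val] at e0 e1 e2 <;>
  subst e0 e1 e2
  · have := key y0 x0 z0 y1 x1 z1 yx yz xz lXZ uXY
    exact ⟨fun h => by linarith [this.1 h], fun h => by linarith [this.2 h]⟩
  · have := key x0 y0 z0 x1 y1 z1 xy xz yz lYZ uXY
    exact ⟨fun h => by linarith [this.1 h], fun h => by linarith [this.2 h]⟩
  · have := key y0 z0 x0 y1 z1 x1 yz yx zx lXZ uYZ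
    exact ⟨fun h => by linarith [this.1 h], fun h => by linarith [this.2 h]⟩
  · have := key z0 y0 x0 z1 y1 x1 zy zx yx lXY uYZ
    exact ⟨fun h => by linarith [this.1 h], fun h => by linarith [this.2 h]⟩
  · have := key x0 z0 y0 x1 z1 y1 xz xy zy lYZ uXZ
    exact ⟨fun h => by linarith [this.1 h], fun h => by linarith [this.2 h]⟩
  · have := key z0 x0 y0 z1 x1 y1 zx zy xy lXY uXZ
    exact ⟨fun h => by linarith [this.1 h], fun h => by linarith [this.2 h]⟩
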